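/- Let $D$ be a planar diagram of a knot with $m \ge 0$ crossings (numbered, unoriented). Assume that $D$ is alternating (along the knot one alternately over- and undercrosses) and that no crossing of $D$ is splitting (nugatory), where a crossing is splitting if it connects two otherwise disconnected parts of $D$, i.e. if two of the four strand ends at it lie in different connected components of $D$ with that double point removed. A Kauffman state of $D$ is a choice of a $0$- or $1$-smoothing at each crossing, where the $0$-smoothing merges the two regions swept out by the upper strand when it is turned counterclockwise towards the lower strand. Let $\mathcal H(D)=\bigoplus_{i,j}\mathcal H(D)^{i,j}$ be the (unnormalized) Khovanov homology of $D$ over $\mathbb Z$: the homology of the complex $$\mathcal C(D)=\bigoplus_{S}\mathcal A^{\otimes\{\text{circles of }S\}}[r(S)]\{r(S)\},$$ where $S$ runs over the Kauffman states of $D$, $r(S)$ is the number of $1$-smoothings in $S$, $\mathcal A=\mathbb Z[X]/(X^2)$ with $1$ in bidegree $(0,1)$ and $X$ in bidegree $(0,-1)$, $(M[a]\{b\})^{i,j}=M^{i-a,j-b}$, and the differential, of bidegree $(1,0)$, is the signed sum over the edges of the cube of smoothings of the maps induced by the product of $\mathcal A$ (two circles merge) and the coproduct $1\mapsto 1\otimes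 X+X\otimes 1$, $X\mapsto X\otimes X$ (a circle splits). Then there are Kauffman states of $D$ consisting of exactly one circle, and the number $n_1=r(S)$ is the same for all such states $S$. Let $i_-$ and $i_+$ be the smallest and the largest primary degree $i$ in which $\mathcal H(D)$ is non-zero, i.e. in which $\mathcal H(D)^{i,j}\neq 0$ for some $j$, and put $j_-=2i_--n_1-1$ and $j_+=2i_+-n_1+1$. Then $i_-$ and $i_+$ exist, and $$\mathcal H(D)^{i_-,j_-}\cong\mathbb Z,\qquad \mathcal H(D)^{i_+,j_+}\cong\mathbb Z,\qquad i_-=0,\qquad i_+=m.$$ -/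

import Mathlib

/-- An (unoriented) link diagram with numbered crossings on a closed oriented surface, given by a
planar diagram code; planarity is imposed in `LinkDiagram` below. `crossings` is the number of crossings and `arcs` the number of arcs, i.e. of connected
components of the diagram with its double points removed. The four strand ends at a crossing `c`
are numbered `0, 1, 2, 3` in counterclockwise order such that the ends `0, 2` belong to the lower
strand and the ends `1, 3` to the upper strand, and `pd c k` is the arc that ends there. An arc
either has two ends or is a circle without crossings (and has none). -/
structure PreLinkDiagram where
  crossings : ℕ
  arcs : ℕ
  pd : Fin crossings → Fin 4 → Fin arcs
  ends : ∀ a : Fin arcs,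
    Nat.card {p : Fin crossings × Fin 4 // pd p.1 p.2 = a} = 2 ∨
    Nat.card {p : Fin crossings × Fin 4 // pd p.1 p.2 = a} = 0

namespace PreLinkDiagram

variable (D : PreLinkDiagram)

/-- The corner `(c, k)` is the corner at `c` between the strand ends `k` and `k + 1`. Walking along
an arc from its end `(c, k)` to its other end `(c', k')`, one has the corner `(c, k)` on the left
when leaving `c` and the corner `(c', k' - 1)` on the left when arriving at `c'`: these two corners
are joined along the left side of the arc. -/
def CornerAdj (p q : Fin D.crossings × Fin 4) : Prop :=
  ∃ k' : Fin 4, p ≠ (q.1, k') ∧ D.pd p.1 p.2 = D.pd q.1 k' ∧ q.2 = k' - 1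

/-- The faces of the oriented surface obtained by gluing discs along the corner cycles. -/
def Face : Type := Quot D.CornerAdj

/-- Two crossings are adjacent if some arc ends at both of them. -/
def CrossingAdj (c c' : Fin D.crossings) : Prop := ∃ k k', D.pd c k = D.pd c' k'

/-- The connected components of the diagram that contain a crossing. -/
def Piece : Type := Quot D.CrossingAdj

/-- The diagram is planar: with `V` crossings, `E = 2 * V` arcs with ends, `F` faces and `P`
connected pieces (crossingless circles aside), Euler's formula `V - E + F = 2 * P` holds, i.e. the
surface of every piece is a sphere. -/
def IsPlanar : Prop := Nat.card D.Face = D.crossings + 2 * Nat.card D.Piece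

end PreLinkDiagram

/-- A (planar) link diagram. For a knot diagram, which is connected, the planar diagram code
determines the diagram on the sphere up to isotopy. -/
structure LinkDiagram extends PreLinkDiagram where
  planar : toPreLinkDiagram.IsPlanar

namespace LinkDiagram

variable (D : LinkDiagram)

/-- Passing straight through a crossing, on the lower or on the upper strand. -/
inductive StrandAdj : Fin D.arcs → Fin D.arcs → Prop
  | lower (c : Fin D.crossings) : StrandAdj (D.pd c 0) (D.pd c 2)
  | upper (c : Fin D.crossings) : StrandAdj (D.pd c 1) (D.pd c 3)

/-- A knot diagram is a link diagram with exactly one link component. -/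
def IsKnot : Prop := Nat.card (Quot D.StrandAdj) = 1

/-- The strand ends of the upper strand at a crossing. -/
def IsOver (k : Fin 4) : Prop := k = 1 ∨ k = 3

/-- Along the link one alternately over- and undercrosses: whenever `(c, k)` and `(c', k')` are the
two ends of an arc, exactly one of them is on an upper strand. -/
def IsAlternating : Prop :=
  ∀ (c c' : Fin D.crossings) (k k' : Fin 4),
    (c, k) ≠ (c', k') → D.pd c k = D.pd c' k' → (IsOver k ↔ ¬ IsOver k')

/-- Two arcs that meet at some crossing other than `c`. -/
def AdjAwayFrom (c : Fin D.crossings) (a b : Fin D.arcs) : Prop :=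
  ∃ c', c' ≠ c ∧ ∃ k k', a = D.pd c' k ∧ b = D.pd c' k'

/-- A crossing `c` is splitting (nugatory) if it connects two otherwise disconnected parts of the
diagram: two of the strand ends at `c` lie in different connected components of the complement of
the double point `c` in the diagram. -/
def IsSplitting (c : Fin D.crossings) : Prop :=
  ∃ k k', ¬ Relation.EqvGen (D.AdjAwayFrom c) (D.pd c k) (D.pd c k')

/-- A Kauffman state: `false` stands for the `0`-smoothing, `true` for the `1`-smoothing. -/
abbrev State : Type := Fin D.crossings → Bool

/-- Arcs joined by a smoothing. The `0`-smoothing merges the two regions that the upper strand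
sweeps out when it is turned counterclockwise towards the lower strand (the corners between the
ends `1, 2` and between the ends `3, 0`), so it joins the ends `0, 1` and the ends `2, 3`. The
`1`-smoothing joins the ends `1, 2` and the ends `3, 0`. -/
inductive SmoothAdj (s : D.State) : Fin D.arcs → Fin D.arcs → Prop
  | zero_left (c : Fin D.crossings) : s c = false → SmoothAdj s (D.pd c 0) (D.pd c 1)
  | zero_right (c : Fin D.crossings) : s c = false → SmoothAdj s (D.pd c 2) (D.pd c 3)
  | one_left (c : Fin D.crossings) : s c = true → SmoothAdj s (D.pd c 1) (D.pd c 2)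
  | one_right (c : Fin D.crossings) : s c = true → SmoothAdj s (D.pd c 3) (D.pd c 0)

/-- The circles of a Kauffman state. -/
def Circle (s : D.State) : Type := Quot (D.SmoothAdj s)

/-- The circle of the Kauffman state `s` that contains the arc `a`. -/
def circle (s : D.State) (a : Fin D.arcs) : D.Circle s := Quot.mk _ a

instance (s : D.State) : Finite (D.Circle s) :=
  inferInstanceAs (Finite (Quot (D.SmoothAdj s)))

noncomputable instance (s : D.State) : Fintype (D.Circle s) := Fintype.ofFinite _

/-- The number of `1`-smoothings of a Kauffman state. -/
def numOnes (s : D.State) : ℕ := (Finset.univ.filter fun c => s c = true).card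

/-- The Kauffman states that consist of exactly one circle. -/
def IsOneCircle (s : D.State) : Prop := Nat.card (D.Circle s) = 1

/-- The standard basis of the underlying module `⨁ₛ 𝒜^{⊗ circles of s}` of the Khovanov complex,
where `𝒜` is free on `1` (of degree `1`) and `X` (of degree `-1`): a Kauffman state together with a
basis vector of `𝒜` for each of its circles, `true` standing for `1` and `false` for `X`. -/
structure EnhancedState where
  state : D.State
  label : D.Circle state → Bool

instance : Finite D.EnhancedState :=
  Finite.of_injective
    (fun x => (⟨x.state, x.label⟩ : Σ s : D.State, D.Circle s → Bool)) (by
      rintro ⟨s, e⟩ ⟨t, f⟩ h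
      simp only [Sigma.mk.injEq] at h
      obtain ⟨rfl, h⟩ := h
      simpa using h)

noncomputable instance : Fintype D.EnhancedState := Fintype.ofFinite _

/-- The degree of a basis vector of `𝒜`. -/
def labelDeg (b : Bool) : ℤ := if b then 1 else -1

variable {D} in
/-- The primary (homological) degree. -/
def EnhancedState.deg (x : D.EnhancedState) : ℤ := D.numOnes x.state

variable {D} in
/-- The secondary (quantum) degree: the degree in `𝒜^{⊗ k}`, shifted by the number of
`1`-smoothings. -/
noncomputable def EnhancedState.qdeg (x : D.EnhancedState) : ℤ :=
  (∑ γ, labelDeg (x.label γ)) + D.numOnes x.state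

/-- The coefficient of `w` in the product `u * v` of the ring `𝒜 = ℤ[X] / (X ^ 2)`:
`1 * 1 = 1`, `1 * X = X * 1 = X`, `X * X = 0`. -/
def mulCoeff : Bool → Bool → Bool → ℤ
  | true, true, true => 1
  | true, false, false => 1
  | false, true, false => 1
  | _, _, _ => 0

/-- The coefficient of `v ⊗ w` in the coproduct of `u`:
`Δ 1 = 1 ⊗ X + X ⊗ 1`, `Δ X = X ⊗ X`. -/
def comulCoeff : Bool → Bool → Bool → ℤ
  | true, true, false => 1
  | true, false, true => 1
  | false, false, false => 1
  | _, _, _ => 0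

open Classical in
/-- The coefficient of `y` in the image of `x` under the map that belongs to changing the smoothing
of `c` from `0` to `1`: circles that do not meet `c` keep their labels, and at `c` two circles are
merged by the product, or one circle is split by the coproduct, of `𝒜`. The sign is the usual one
of the cube of smoothings. -/
noncomputable def edgeCoeff (c : Fin D.crossings) (x y : D.EnhancedState) : ℤ :=
  if x.state c = false ∧ y.state = Function.update x.state c true ∧
      (∀ a, (∀ k, D.circle x.state a ≠ D.circle x.state (D.pd c k)) →
        x.label (D.circle x.state a) = y.label (D.circle y.state a)) then
    (-1) ^ (Finset.univ.filter fun c' => c' < c ∧ x.state c' = true).card *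
      (if D.circle x.state (D.pd c 0) ≠ D.circle x.state (D.pd c 2) then
        mulCoeff (x.label (D.circle x.state (D.pd c 0))) (x.label (D.circle x.state (D.pd c 2)))
          (y.label (D.circle y.state (D.pd c 0)))
      else if D.circle y.state (D.pd c 0) ≠ D.circle y.state (D.pd c 2) then
        comulCoeff (x.label (D.circle x.state (D.pd c 0)))
          (y.label (D.circle y.state (D.pd c 0))) (y.label (D.circle y.state (D.pd c 2)))
      else 0)
  else 0

/-- The underlying module of the Khovanov complex. -/
abbrev Chain : Type := D.EnhancedState →₀ ℤ

/-- The differential of the Khovanov complex. -/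
noncomputable def d : D.Chain →ₗ[ℤ] D.Chain :=
  Finsupp.linearCombination ℤ fun x =>
    ∑ y, (∑ c, D.edgeCoeff c x y) • Finsupp.single y (1 : ℤ)

/-- The homogeneous component of bidegree `(i, j)` of the Khovanov complex. -/
def chains (i j : ℤ) : Submodule ℤ D.Chain :=
  Finsupp.supported ℤ ℤ {x : D.EnhancedState | x.deg = i ∧ x.qdeg = j}

/-- The cycles of bidegree `(i, j)`. -/
noncomputable def cycles (i j : ℤ) : Submodule ℤ D.Chain := LinearMap.ker D.d ⊓ D.chains i j

/-- The boundaries of bidegree `(i, j)`; the differential has bidegree `(1, 0)`. -/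
noncomputable def boundaries (i j : ℤ) : Submodule ℤ D.Chain := (D.chains (i - 1) j).map D.d

/-- The Khovanov homology of the diagram in bidegree `(i, j)`: cycles modulo boundaries, without
any normalization of the degrees by the writhe. -/
abbrev Homology (i j : ℤ) : Type :=
  D.cycles i j ⧸ (D.boundaries i j).submoduleOf (D.cycles i j)

/-- The primary degrees in which the Khovanov homology is non-zero. -/
def homologySupport : Set ℤ := {i | ∃ j, Nontrivial (D.Homology i j)}

end LinkDiagram

/-! Write `c₀` and `c₁` for the numbers of circles of the all-0 and the all-1 state. Changing one
smoothing loses at most one circle, and does lose one when two circles meet at the crossing. A state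
with fewest circles thus has no such crossing, and on a knot this leaves a single circle.

Walking from the two constant states to a one-circle state `s` gives `c₀ ≤ 1 + r(s)` and `c₁ ≤ 1 + m
- r(s)`. In an alternating diagram the faces are the circles of the two constant states
(`faceEquiv`), so Euler's formula reads `c₀ + c₁ = m + 2`. Both bounds are therefore equalities, and
`n₁ = c₀ - 1`.

A nonsplitting crossing admits a one-circle state with either smoothing there. If all its ends lay
on one circle of a constant state, a walk starting at that crossing would lose no circle in its
first step, making a bound strict. Hence the constant states are adequate
(`not_oneCircleAt_constState`): two circles meet at every crossing. The all-0 state labelled by `X`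
throughout is then a cycle, as `X * X = 0`, and nothing maps to it; the all-1 state labelled by `1`
throughout maps to nothing and is never hit, as `Δ` has no term `1 ⊗ 1`. Each is alone in its
bidegree and so spans a copy of `ℤ`, in the extreme degrees `0` and `m` of the complex. -/

namespace LinkDiagram

variable {D : LinkDiagram}

/-! ### Circle counts under one change of smoothing -/

/-- The number of circles of a Kauffman state. -/
noncomputable def numCircles (s : D.State) : ℕ := Nat.card (D.Circle s)

/-- All four strand ends at a crossing lie on one circle of the state. -/
def OneCircleAt (s : D.State) (c : Fin D.crossings) : Prop :=
  D.circle s (D.pd c 0) = D.circle s (D.pd c 2)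

theorem circle_zero_one {s : D.State} {c : Fin D.crossings} (h : s c = false) :
    D.circle s (D.pd c 0) = D.circle s (D.pd c 1) := Quot.sound (.zero_left c h)

theorem circle_two_three {s : D.State} {c : Fin D.crossings} (h : s c = false) :
    D.circle s (D.pd c 2) = D.circle s (D.pd c 3) := Quot.sound (.zero_right c h)

theorem circle_one_two {s : D.State} {c : Fin D.crossings} (h : s c = true) :
    D.circle s (D.pd c 1) = D.circle s (D.pd c 2) := Quot.sound (.one_left c h)

theorem circle_three_zero {s : D.State} {c : Fin D.crossings} (h : s c = true) :
    D.circle s (D.pd c 3) = D.circle s (D.pd c 0) := Quot.sound (.one_right c h)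

theorem OneCircleAt.circle_eq {s : D.State} {c : Fin D.crossings} (h : OneCircleAt s c)
    (k l : Fin 4) : D.circle s (D.pd c k) = D.circle s (D.pd c l) := by
  suffices H : ∀ k, D.circle s (D.pd c k) = D.circle s (D.pd c 0) from (H k).trans (H l).symm
  unfold OneCircleAt at h
  intro k
  cases hs : s c
  · have h1 := circle_zero_one hs
    have h2 := circle_two_three hs
    fin_cases k <;> simp_all
  · have h1 := circle_one_two hs
    have h2 := circle_three_zero hs
    fin_cases k <;> simp_all

/-- A function on arcs that is constant along the smoothings at all crossings descends to the
circles of the state. -/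
theorem smoothAdj_lift {α : Type*} {s : D.State} (f : Fin D.arcs → α)
    (h₀ : ∀ c, s c = false → f (D.pd c 0) = f (D.pd c 1) ∧ f (D.pd c 2) = f (D.pd c 3))
    (h₁ : ∀ c, s c = true → f (D.pd c 1) = f (D.pd c 2) ∧ f (D.pd c 3) = f (D.pd c 0))
    (a b : Fin D.arcs) (h : D.SmoothAdj s a b) : f a = f b := by
  cases h with
  | zero_left c h => exact (h₀ c h).1
  | zero_right c h => exact (h₀ c h).2
  | one_left c h => exact (h₁ c h).1
  | one_right c h => exact (h₁ c h).2

/-- If a state changes only at a crossing all of whose ends lie on one circle, no circles merge. -/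
theorem numCircles_le_of_oneCircleAt {s t : D.State} {c : Fin D.crossings}
    (hst : ∀ c', c' ≠ c → s c' = t c') (h : OneCircleAt s c) : numCircles s ≤ numCircles t := by
  let f : D.Circle t → D.Circle s := Quot.lift (D.circle s) <| by
    apply smoothAdj_lift
    · intro c' hc'
      by_cases e : c' = c
      · subst e; exact ⟨h.circle_eq _ _, h.circle_eq _ _⟩
      · rw [← hst c' e] at hc'
        exact ⟨circle_zero_one hc', circle_two_three hc'⟩
    · intro c' hc'
      by_cases e : c' = c
      · subst e; exact ⟨h.circle_eq _ _, h.circle_eq _ _⟩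
      · rw [← hst c' e] at hc'
        exact ⟨circle_one_two hc', circle_three_zero hc'⟩
  refine Nat.card_le_card_of_surjective f ?_
  rintro ⟨a⟩
  exact ⟨D.circle t a, rfl⟩

/-- A state change at one crossing merges at most two circles. -/
theorem numCircles_le_add_one {s t : D.State} {c : Fin D.crossings}
    (hst : ∀ c', c' ≠ c → s c' = t c') : numCircles s ≤ numCircles t + 1 := by
  classical
  let x := D.circle s (D.pd c 0)
  let y := D.circle s (D.pd c 2)
  -- Send the circle `y` to `x`; this is constant along the smoothings of `t`.
  let g : D.Circle s → D.Circle s := fun z => if z = y then x else z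
  have hg : ∀ k, g (D.circle s (D.pd c k)) = x := by
    have h0 : g x = x := by simp [g]
    have h2 : g y = x := by simp [g]
    intro k
    cases hs : s c
    · fin_cases k
      · exact h0
      · exact (congrArg g (circle_zero_one hs)).symm.trans h0
      · exact h2
      · exact (congrArg g (circle_two_three hs)).symm.trans h2
    · fin_cases k
      · exact h0
      · exact (congrArg g (circle_one_two hs)).trans h2
      · exact h2
      · exact (congrArg g (circle_three_zero hs)).trans h0
  let f : D.Circle t → D.Circle s := Quot.lift (fun a => g (D.circle s a)) <| by
    apply smoothAdj_lift
    · intro c' hc'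
      by_cases e : c' = c
      · subst e; simp only [hg, and_self]
      · rw [← hst c' e] at hc'
        simp only [circle_zero_one hc', circle_two_three hc', and_self]
    · intro c' hc'
      by_cases e : c' = c
      · subst e; simp only [hg, and_self]
      · rw [← hst c' e] at hc'
        simp only [circle_one_two hc', circle_three_zero hc', and_self]
  -- The value `none` accounts for `y`, the one circle that may be lost.
  have hf : Function.Surjective (fun o : Option (D.Circle t) => o.elim y f) := by
    rintro ⟨a⟩
    by_cases e : D.circle s a = y
    · exact ⟨none, e.symm⟩
    · exact ⟨some (D.circle t a), if_neg e⟩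
  simpa [numCircles, Finite.card_option] using Nat.card_le_card_of_surjective _ hf

/-- A set of arcs that is closed under the smoothings away from a crossing `c` contains an even
number of the strand ends at `c`. -/
theorem even_card_ends {s : D.State} {c : Fin D.crossings} (K : Fin D.arcs → Prop)
    [DecidablePred K]
    (h₀ : ∀ c', c' ≠ c → s c' = false →
      (K (D.pd c' 0) ↔ K (D.pd c' 1)) ∧ (K (D.pd c' 2) ↔ K (D.pd c' 3)))
    (h₁ : ∀ c', c' ≠ c → s c' = true →
      (K (D.pd c' 1) ↔ K (D.pd c' 2)) ∧ (K (D.pd c' 3) ↔ K (D.pd c' 0))) :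
    Even (∑ k, if K (D.pd c k) then 1 else 0) := by
  classical
  let w : Fin D.arcs → ℕ := fun a => if K a then 1 else 0
  -- Summed over all crossings, the ends are counted arc by arc, and each arc has two ends or none.
  have htot : Even (∑ c', ∑ k, w (D.pd c' k)) := by
    rw [← Fintype.sum_prod_type' (f := fun c' k => w (D.pd c' k)),
      ← Finset.sum_fiberwise (s := Finset.univ) (g := fun p : Fin D.crossings × Fin 4 => D.pd p.1 p.2)]
    refine Finset.even_sum _ fun a _ => ?_
    rw [Finset.sum_congr rfl (g := fun _ => w a)
      (fun p hp => by rw [(Finset.mem_filter.1 hp).2]), Finset.sum_const, smul_eq_mul]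
    refine Even.mul_right ?_ _
    have := D.ends a
    rw [Nat.card_eq_fintype_card, Fintype.card_subtype] at this
    rcases this with h | h <;> rw [h] <;> decide
  rw [← Finset.add_sum_erase _ _ (Finset.mem_univ c)] at htot
  refine (Nat.even_add.1 htot).2 (Finset.even_sum _ fun c' hc' => ?_)
  have hc := Finset.ne_of_mem_erase hc'
  rw [Fin.sum_univ_four]
  cases hs : s c'
  · have := h₀ c' hc hs
    simp only [w, this.1, this.2]
    split_ifs <;> decide
  · have := h₁ c' hc hs
    simp only [w, this.1, this.2]
    split_ifs <;> decide

/-- If two circles meet at a crossing, changing the smoothing there merges them. -/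
theorem oneCircleAt_of_not {s t : D.State} {c : Fin D.crossings}
    (hst : ∀ c', c' ≠ c → s c' = t c') (hc : s c ≠ t c) (h : ¬ OneCircleAt s c) :
    OneCircleAt t c := by
  classical
  by_contra h'
  unfold OneCircleAt at h h'
  -- The arcs that lie both on the circle of `s` and on the circle of `t` of the end `0`
  -- contain exactly one strand end at `c`.
  have := even_card_ends (s := s) (c := c)
    (fun a => D.circle s a = D.circle s (D.pd c 0) ∧ D.circle t a = D.circle t (D.pd c 0))
    (by
      intro c' e hs
      have ht := hst c' e ▸ hs
      simp only [circle_zero_one hs, circle_zero_one ht, circle_two_three hs,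
        circle_two_three ht, and_self])
    (by
      intro c' e hs
      have ht := hst c' e ▸ hs
      simp only [circle_one_two hs, circle_one_two ht, circle_three_zero hs,
        circle_three_zero ht, and_self])
  rw [Fin.sum_univ_four] at this
  -- End `1` leaves the circle of the 1-smoothed state; ends `2` and `3` leave that of the
  -- 0-smoothed one.
  have key : ∀ {s t : D.State}, s c = false → t c = true →
      D.circle s (D.pd c 0) ≠ D.circle s (D.pd c 2) →
      D.circle t (D.pd c 0) ≠ D.circle t (D.pd c 2) →
      ¬ D.circle t (D.pd c 1) = D.circle t (D.pd c 0) ∧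
      ¬ D.circle s (D.pd c 2) = D.circle s (D.pd c 0) ∧
      ¬ D.circle s (D.pd c 3) = D.circle s (D.pd c 0) := by
    intro s t hs ht h h'
    rw [circle_one_two ht, ← circle_two_three hs]
    exact ⟨h'.symm, h.symm, h.symm⟩
  cases hs : s c <;> cases ht : t c
  · simp [hs, ht] at hc
  · obtain ⟨h1, h2, h3⟩ := key hs ht h h'
    simp [h1, h2, h3] at this
  · obtain ⟨h1, h2, h3⟩ := key ht hs h' h
    simp [h1, h2, h3] at this
  · simp [hs, ht] at hc

/-- If two circles meet at a crossing, changing the smoothing there lowers the number of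
circles. -/
theorem numCircles_lt_of_not_oneCircleAt {s t : D.State} {c : Fin D.crossings}
    (hst : ∀ c', c' ≠ c → s c' = t c') (hc : s c ≠ t c) (h : ¬ OneCircleAt s c) :
    numCircles t < numCircles s := by
  have ht := oneCircleAt_of_not hst hc h
  let f : D.Circle s → D.Circle t := Quot.lift (D.circle t) <| by
    apply smoothAdj_lift
    · intro c' hc'
      by_cases e : c' = c
      · subst e; exact ⟨ht.circle_eq _ _, ht.circle_eq _ _⟩
      · rw [hst c' e] at hc'
        exact ⟨circle_zero_one hc', circle_two_three hc'⟩
    · intro c' hc'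
      by_cases e : c' = c
      · subst e; exact ⟨ht.circle_eq _ _, ht.circle_eq _ _⟩
      · rw [hst c' e] at hc'
        exact ⟨circle_one_two hc', circle_three_zero hc'⟩
  have hf : Function.Surjective f := by
    rintro ⟨a⟩
    exact ⟨D.circle s a, rfl⟩
  refine lt_of_le_of_ne (Nat.card_le_card_of_surjective f hf) fun e => h ?_
  -- Equal counts would make `f` injective, so the two circles of `s` at `c`, which `f` identifies,
  -- would coincide.
  exact ((Nat.bijective_iff_surjective_and_card f).2 ⟨hf, e.symm⟩).1 ht

/-! ### Walking between states -/

/-- The number of crossings at which two states differ. -/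
def stateDist (s t : D.State) : ℕ := (Finset.univ.filter fun c => s c ≠ t c).card

theorem stateDist_update {s t : D.State} {c : Fin D.crossings} (h : s c ≠ t c) :
    stateDist (Function.update s c (t c)) t + 1 = stateDist s t := by
  have hm : c ∈ Finset.univ.filter fun c => s c ≠ t c := by simpa using h
  rw [stateDist, stateDist, ← Finset.card_erase_add_one hm]
  congr 2
  ext c'
  by_cases e : c' = c
  · subst e; simp
  · simp [e]

theorem update_agree (s : D.State) (c : Fin D.crossings) (b : Bool) :
    ∀ c', c' ≠ c → s c' = Function.update s c b c' :=
  fun _ e => (Function.update_of_ne e _ _).symm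

theorem numCircles_le_add_stateDist (s t : D.State) :
    numCircles s ≤ numCircles t + stateDist s t := by
  induction h : stateDist s t generalizing s with
  | zero =>
    have : s = t := by
      funext c
      by_contra hc
      have := stateDist_update hc
      omega
    simp [this]
  | succ n ih =>
    have : ∃ c, s c ≠ t c := by
      by_contra! hn
      simp [stateDist, hn] at h
    obtain ⟨c, hc⟩ := this
    have h1 := stateDist_update hc
    have h2 := ih (Function.update s c (t c)) (by omega)
    have h3 := numCircles_le_add_one (update_agree s c (t c))
    omega

/-- If `s` has a crossing with all ends on one circle where it differs from `t`, the first step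
from `s` towards `t` need not merge circles. -/
theorem numCircles_lt_add_stateDist {s t : D.State} {c : Fin D.crossings} (hc : s c ≠ t c)
    (h : OneCircleAt s c) : numCircles s < numCircles t + stateDist s t := by
  have h1 := stateDist_update hc
  have h2 := numCircles_le_add_stateDist (Function.update s c (t c)) t
  have h3 := numCircles_le_of_oneCircleAt (update_agree s c (t c)) h
  omega

/-! ### Knot diagrams and one-circle states -/

/-- On a knot diagram, a function on arcs that is constant along the strands is constant. -/
theorem IsKnot.eq_of_strand (hD : D.IsKnot) {α : Type*} (f : Fin D.arcs → α)
    (hl : ∀ c, f (D.pd c 0) = f (D.pd c 2)) (hu : ∀ c, f (D.pd c 1) = f (D.pd c 3))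
    (a b : Fin D.arcs) : f a = f b := by
  let g : Quot D.StrandAdj → α := Quot.lift f <| by
    rintro _ _ (c | c)
    · exact hl c
    · exact hu c
  have := (Nat.card_eq_one_iff_unique.1 hD).1
  exact congrArg g (Subsingleton.elim (Quot.mk _ a) (Quot.mk _ b))

theorem IsKnot.nonempty_arcs (hD : D.IsKnot) : Nonempty (Fin D.arcs) := by
  obtain ⟨⟨a⟩⟩ := (Nat.card_eq_one_iff_unique.1 hD).2
  exact ⟨a⟩

/-- On a knot diagram with at least one crossing every arc has two ends. -/
theorem IsKnot.card_ends (hD : D.IsKnot) (c : Fin D.crossings) (a : Fin D.arcs) :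
    Nat.card {p : Fin D.crossings × Fin 4 // D.pd p.1 p.2 = a} = 2 := by
  refine (D.ends a).resolve_right fun h => ?_
  have hne : ∀ c' k, D.pd c' k ≠ a := by
    intro c' k e
    have := Finite.card_eq_zero_iff.1 h
    exact this.false ⟨(c', k), e⟩
  -- An arc without ends would be a link component by itself.
  have := hD.eq_of_strand (fun b => b = a) (fun c => by simp [hne]) (fun c => by simp [hne])
    (D.pd c 0) a
  simp [hne] at this

theorem IsKnot.card_piece (hD : D.IsKnot) (c : Fin D.crossings) : Nat.card D.Piece = 1 := by
  let mk : Fin D.crossings → D.Piece := Quot.mk _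
  have hmk : ∀ {c c' k k'}, D.pd c k = D.pd c' k' → mk c = mk c' :=
    fun {c c' k k'} h => Quot.sound ⟨k, k', h⟩
  rw [Nat.card_eq_one_iff_unique]
  refine ⟨⟨?_⟩, ⟨mk c⟩⟩
  rintro ⟨c₁⟩ ⟨c₂⟩
  have key : ∀ c' k l, (∀ c k, D.pd c k = D.pd c' l → mk c = mk c₂) →
      ∀ c k', D.pd c k' = D.pd c' k → mk c = mk c₂ :=
    fun c' k l h c k' e => (hmk e).trans (h c' l rfl)
  -- The property "every crossing at which `a` ends lies in the piece of `c₂`" propagates along the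
  -- strands.
  have := hD.eq_of_strand (fun a => ∀ c k, D.pd c k = a → mk c = mk c₂)
    (fun c' => propext ⟨key c' 2 0, key c' 0 2⟩) (fun c' => propext ⟨key c' 3 1, key c' 1 3⟩)
    (D.pd c₂ 0) (D.pd c₁ 0)
  exact this.mp (fun c k e => hmk e) c₁ 0 rfl

/-- If no two circles of a state of a knot diagram meet at a crossing, there is only one circle. -/
theorem IsKnot.numCircles_eq_one (hD : D.IsKnot) {s : D.State} (h : ∀ c, OneCircleAt s c) :
    numCircles s = 1 := by
  refine Nat.card_eq_one_iff_unique.2 ⟨⟨?_⟩, hD.nonempty_arcs.map (D.circle s)⟩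
  rintro ⟨a⟩ ⟨b⟩
  exact hD.eq_of_strand (D.circle s) (fun c => h c) (fun c => (h c).circle_eq _ _) a b

/-- A crossing that is not splitting can be left out in `IsKnot.numCircles_eq_one`. -/
theorem IsKnot.numCircles_eq_one_of_not_isSplitting (hD : D.IsKnot) {s : D.State}
    {c : Fin D.crossings} (hc : ¬ D.IsSplitting c) (h : ∀ c', c' ≠ c → OneCircleAt s c') :
    numCircles s = 1 := by
  refine hD.numCircles_eq_one fun c' => ?_
  by_cases e : c' = c
  · subst e
    simp only [IsSplitting, not_exists, not_not] at hc
    -- The ends at the omitted crossing are connected through the other crossings, and at each of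
    -- those only one circle is present.
    have H : ∀ {a b}, Relation.EqvGen (D.AdjAwayFrom c') a b → D.circle s a = D.circle s b := by
      intro a b hab
      induction hab with
      | rel _ _ hr =>
        obtain ⟨c₁, h₁, k, k', rfl, rfl⟩ := hr
        exact (h c₁ h₁).circle_eq _ _
      | refl => rfl
      | symm _ _ _ ih => exact ih.symm
      | trans _ _ _ _ _ ih₁ ih₂ => exact ih₁.trans ih₂
    exact H (hc 0 2)
  · exact h c' e

/-- A state with the fewest circles works: two circles meeting at a crossing could still be merged.
-/
theorem IsKnot.exists_isOneCircle (hD : D.IsKnot) : ∃ s, D.IsOneCircle s := by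
  obtain ⟨s, hs⟩ := Finite.exists_min (numCircles (D := D))
  refine ⟨s, hD.numCircles_eq_one fun c => ?_⟩
  by_contra hc
  exact (hs _).not_gt (numCircles_lt_of_not_oneCircleAt (update_agree s c (!s c)) (by simp) hc)

/-- The smoothing at a crossing that is not splitting can be prescribed in a one-circle state. -/
theorem IsKnot.exists_isOneCircle_apply_eq (hD : D.IsKnot) {c : Fin D.crossings}
    (hc : ¬ D.IsSplitting c) (b : Bool) : ∃ s, D.IsOneCircle s ∧ s c = b := by
  have : Nonempty {s : D.State // s c = b} := ⟨⟨fun _ => b, rfl⟩⟩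
  -- Minimize only over the states with the prescribed smoothing; a change at any other crossing
  -- stays in this class.
  obtain ⟨⟨s, hb⟩, hs⟩ :=
    Finite.exists_min (fun s : {s : D.State // s c = b} => numCircles s.1)
  refine ⟨s, hD.numCircles_eq_one_of_not_isSplitting hc fun c' e => ?_, hb⟩
  by_contra hc'
  exact (hs ⟨Function.update s c' (!s c'), by rwa [Function.update_of_ne e.symm]⟩).not_gt
    (numCircles_lt_of_not_oneCircleAt (update_agree s c' (!s c')) (by simp) hc')

/-! ### Constant states, faces and Euler's formula -/

/-- The state with the same smoothing at all crossings. -/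
def constState (D : LinkDiagram) (b : Bool) : D.State := fun _ => b

theorem stateDist_constState_false (s : D.State) :
    stateDist (D.constState false) s = D.numOnes s := by
  simp [stateDist, constState, numOnes]

theorem numOnes_add_stateDist (s : D.State) :
    D.numOnes s + stateDist (D.constState true) s = D.crossings := by
  have := Finset.card_filter_add_card_filter_not (s := Finset.univ) (fun c => s c = true)
  simp only [Finset.card_univ, Fintype.card_fin] at this
  rw [← this, numOnes, stateDist]
  congr 3
  simp [constState]

/-- An arc has at most one end on an upper strand and at most one on a lower strand. -/
theorem IsAlternating.eq_of_pd_eq (halt : D.IsAlternating) {p q : Fin D.crossings × Fin 4}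
    (h : D.pd p.1 p.2 = D.pd q.1 q.2) (ho : IsOver p.2 ↔ IsOver q.2) : p = q := by
  by_contra hne
  have := halt p.1 q.1 p.2 q.2 hne h
  tauto

/-- The two ends of an arc are of opposite type. The crossing `c` only serves to rule out a
crossingless circle. -/
theorem exists_end (hD : D.IsKnot) (halt : D.IsAlternating) (c : Fin D.crossings)
    (o : Prop) (a : Fin D.arcs) :
    ∃ p : Fin D.crossings × Fin 4, D.pd p.1 p.2 = a ∧ (IsOver p.2 ↔ o) := by
  obtain ⟨p, q, hpq, -⟩ := Nat.card_eq_two_iff.1 (hD.card_ends c a)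
  have hne : p.1 ≠ q.1 := fun e => hpq (Subtype.ext e)
  have h := halt p.1.1 q.1.1 p.1.2 q.1.2 hne (p.2.trans q.2.symm)
  by_cases ho : IsOver p.1.2 ↔ o
  · exact ⟨p.1, p.2, ho⟩
  · refine ⟨q.1, q.2, ?_⟩
    by_cases IsOver q.1.2 <;> by_cases o <;> simp_all

theorem isOver_iff (k : Fin 4) : IsOver k ↔ ¬ (k = 0 ∨ k = 2) := by
  unfold IsOver; fin_cases k <;> simp

/-- The end of an arc on an upper strand or, if `o` is false, on a lower strand. -/
noncomputable def arcEnd (hD : D.IsKnot) (halt : D.IsAlternating) (c : Fin D.crossings)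
    (o : Prop) (a : Fin D.arcs) : Fin D.crossings × Fin 4 :=
  (exists_end hD halt c o a).choose

theorem arcEnd_spec (hD : D.IsKnot) (halt : D.IsAlternating) (c : Fin D.crossings) (o : Prop)
    (a : Fin D.arcs) : D.pd (arcEnd hD halt c o a).1 (arcEnd hD halt c o a).2 = a ∧
      (IsOver (arcEnd hD halt c o a).2 ↔ o) :=
  (exists_end hD halt c o a).choose_spec

theorem arcEnd_pd (hD : D.IsKnot) (halt : D.IsAlternating) (c : Fin D.crossings) {o : Prop}
    (p : Fin D.crossings × Fin 4) (hp : IsOver p.2 ↔ o) :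
    arcEnd hD halt c o (D.pd p.1 p.2) = p :=
  have h := arcEnd_spec hD halt c o (D.pd p.1 p.2)
  halt.eq_of_pd_eq h.1 (h.2.trans hp.symm)

/-- The face at a corner. -/
def face (D : LinkDiagram) (p : Fin D.crossings × Fin 4) : D.Face := Quot.mk _ p

/-- Going along an arc from its end on one strand to its end on the other strand. -/
theorem face_arcEnd (hD : D.IsKnot) (halt : D.IsAlternating) (c : Fin D.crossings) {o : Prop}
    (p : Fin D.crossings × Fin 4) (hp : IsOver p.2 ↔ ¬ o) :
    D.face (arcEnd hD halt c o (D.pd p.1 p.2)) = D.face (p.1, p.2 - 1) := by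
  obtain ⟨h, ho⟩ := arcEnd_spec hD halt c o (D.pd p.1 p.2)
  refine Quot.sound ⟨p.2, fun e => ?_, h, rfl⟩
  rw [show arcEnd hD halt c o (D.pd p.1 p.2) = p from e] at ho
  tauto

theorem circle_succ_of_not_isOver {c : Fin D.crossings} {k : Fin 4} (hk : ¬ IsOver k) :
    D.circle (D.constState false) (D.pd c k) = D.circle (D.constState false) (D.pd c (k + 1)) := by
  rw [isOver_iff, not_not] at hk
  rcases hk with rfl | rfl
  · exact circle_zero_one rfl
  · exact circle_two_three rfl

theorem circle_succ_of_isOver {c : Fin D.crossings} {k : Fin 4} (hk : IsOver k) :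
    D.circle (D.constState true) (D.pd c k) = D.circle (D.constState true) (D.pd c (k + 1)) := by
  rcases hk with rfl | rfl
  · exact circle_one_two rfl
  · exact circle_three_zero rfl

theorem isOver_add_one (k : Fin 4) : IsOver (k + 1) ↔ ¬ IsOver k := by
  unfold IsOver; fin_cases k <;> simp

open Classical in
/-- The faces of an alternating knot diagram with a crossing are the circles of the two constant
states. -/
noncomputable def faceEquiv (hD : D.IsKnot) (halt : D.IsAlternating) (c : Fin D.crossings) :
    D.Face ≃ D.Circle (D.constState false) ⊕ D.Circle (D.constState true) where
  toFun := Quot.lift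
    (fun p => if IsOver p.2 then .inr (D.circle _ (D.pd p.1 p.2))
      else .inl (D.circle _ (D.pd p.1 p.2))) <| by
    rintro p ⟨c', k⟩ ⟨k', hne, hpd, rfl : k = k' - 1⟩
    have h := halt p.1 c' p.2 k' hne hpd
    obtain ⟨k, rfl⟩ : ∃ k, k' = k + 1 := ⟨k' - 1, by abel⟩
    -- Alternation makes `k'` opposite in type to `p.2`, so adjacent corners `p.2` and `k' - 1` have
    -- the same type: faces are two-coloured.
    rw [isOver_add_one, not_not] at h
    simp only [add_sub_cancel_right, h, hpd]
    split_ifs with hk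
    · rw [circle_succ_of_isOver hk]
    · rw [circle_succ_of_not_isOver hk]
  invFun := Sum.elim
    -- Each arc borders a face of either colour, namely the one at the corner of its end of that
    -- type.
    (Quot.lift (fun a => D.face (arcEnd hD halt c False a)) <| by
      apply smoothAdj_lift
      · intro c' _
        rw [arcEnd_pd hD halt c (c', 0) (by simp [IsOver]),
          arcEnd_pd hD halt c (c', 2) (by simp [IsOver]),
          face_arcEnd hD halt c (c', 1) (by simp [IsOver]),
          face_arcEnd hD halt c (c', 3) (by simp [IsOver])]
        exact ⟨rfl, rfl⟩
      · intro c' h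
        simp [constState] at h)
    (Quot.lift (fun a => D.face (arcEnd hD halt c True a)) <| by
      apply smoothAdj_lift
      · intro c' h
        simp [constState] at h
      · intro c' _
        rw [arcEnd_pd hD halt c (c', 1) (by simp [IsOver]),
          arcEnd_pd hD halt c (c', 3) (by simp [IsOver]),
          face_arcEnd hD halt c (c', 2) (by simp [IsOver]),
          face_arcEnd hD halt c (c', 0) (by simp [IsOver])]
        exact ⟨rfl, rfl⟩)
  left_inv := by
    rintro ⟨p⟩
    by_cases hp : IsOver p.2
    · simp only [hp, if_true]
      exact congrArg D.face (arcEnd_pd hD halt c p (by simp [hp]))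
    · simp only [hp, if_false]
      exact congrArg D.face (arcEnd_pd hD halt c p (by simp [hp]))
  right_inv := by
    rintro (x | x) <;> obtain ⟨a⟩ := x
    · obtain ⟨h, ho⟩ := arcEnd_spec hD halt c False a
      exact (if_neg (by simpa using ho)).trans (congrArg (fun b => Sum.inl (D.circle _ b)) h)
    · obtain ⟨h, ho⟩ := arcEnd_spec hD halt c True a
      exact (if_pos (by simpa using ho)).trans (congrArg (fun b => Sum.inr (D.circle _ b)) h)

/-- Euler's formula for an alternating knot diagram. -/
theorem numCircles_constState_add (hD : D.IsKnot) (halt : D.IsAlternating) :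
    numCircles (D.constState false) + numCircles (D.constState true) = D.crossings + 2 := by
  by_cases h : D.crossings = 0
  · have hE : IsEmpty (Fin D.crossings) := by rw [h]; infer_instance
    rw [hD.numCircles_eq_one fun c => hE.elim c, hD.numCircles_eq_one fun c => hE.elim c, h]
  · let c : Fin D.crossings := ⟨0, Nat.pos_of_ne_zero h⟩
    have := D.planar
    rw [PreLinkDiagram.IsPlanar, hD.card_piece c, Nat.card_congr (faceEquiv hD halt c),
      Nat.card_sum] at this
    exact this

/-- The bounds from the two constant states add up to `m + 2`, which Euler's formula attains, so
each is sharp. -/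
theorem numOnes_add_one (hD : D.IsKnot) (halt : D.IsAlternating) {s : D.State}
    (hs : D.IsOneCircle s) : D.numOnes s + 1 = numCircles (D.constState false) := by
  have h1 : numCircles s = 1 := hs
  have h2 := numCircles_le_add_stateDist (D.constState false) s
  have h3 := numCircles_le_add_stateDist (D.constState true) s
  have h4 := numCircles_constState_add hD halt
  have h5 := numOnes_add_stateDist s
  rw [stateDist_constState_false] at h2
  omega

/-- The constant states of an alternating knot diagram without splitting crossings are adequate. -/
theorem not_oneCircleAt_constState (hD : D.IsKnot) (halt : D.IsAlternating)
    {c : Fin D.crossings} (hc : ¬ D.IsSplitting c) (b : Bool) :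
    ¬ OneCircleAt (D.constState b) c := by
  intro h
  -- A one-circle state that differs from the constant state at `c` makes the sharp bound strict.
  obtain ⟨s, hs, hsc⟩ := hD.exists_isOneCircle_apply_eq hc (!b)
  have h1 : numCircles s = 1 := hs
  have h2 := numCircles_lt_add_stateDist (t := s) (by simp [constState, hsc]) h
  have h4 := numCircles_constState_add hD halt
  have h5 := numOnes_add_stateDist s
  have h6 := numOnes_add_one hD halt hs
  cases b
  · rw [stateDist_constState_false] at h2
    omega
  · omega

/-! ### Homology in the extreme bidegrees -/

/-- If the component of bidegree `(i, j)` has a single basis vector, and no component of the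
differential starts or ends at it, the homology there is infinite cyclic. -/
theorem nonempty_homology_equiv {i j : ℤ} {x₀ : D.EnhancedState}
    (hx : ∀ x : D.EnhancedState, x.deg = i ∧ x.qdeg = j ↔ x = x₀)
    (hout : ∀ c y, D.edgeCoeff c x₀ y = 0) (hin : ∀ c x, D.edgeCoeff c x x₀ = 0) :
    Nonempty (D.Homology i j ≃ₗ[ℤ] ℤ) := by
  have hset : {x : D.EnhancedState | x.deg = i ∧ x.qdeg = j} = {x₀} := Set.ext hx
  have hch : D.chains i j = Finsupp.supported ℤ ℤ {x₀} := by rw [chains, hset]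
  have hcyc : D.cycles i j = D.chains i j := by
    refine inf_eq_right.2 ?_
    rw [hch, Finsupp.supported_eq_span_single, Submodule.span_le]
    rintro _ ⟨_, rfl, rfl⟩
    simp [d, hout]
  have hd : ∀ w, D.d w x₀ = 0 := by
    intro w
    rw [d, Finsupp.linearCombination_apply, Finsupp.sum_apply, Finsupp.sum]
    refine Finset.sum_eq_zero fun x _ => ?_
    simp only [Finsupp.smul_apply, Finsupp.coe_finsetSum, Finset.sum_apply]
    rw [Finset.sum_eq_zero, smul_zero]
    intro y _
    by_cases e : y = x₀
    · subst e; simp [hin]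
    · simp [e]
  have hb : (D.boundaries i j).submoduleOf (D.cycles i j) = ⊥ := by
    rw [eq_bot_iff]
    rintro ⟨z, hz⟩ ⟨w, -, rfl : D.d w = z⟩
    rw [hcyc, hch, Finsupp.mem_supported'] at hz
    refine (Submodule.mem_bot ℤ).2 (Subtype.ext (Finsupp.ext fun x => ?_))
    by_cases e : x = x₀
    · subst e; exact hd w
    · exact hz x e
  exact ⟨Submodule.quotEquivOfEqBot _ hb ≪≫ₗ LinearEquiv.ofEq _ _ (hcyc.trans hch) ≪≫ₗ
    Finsupp.supportedEquivFinsupp {x₀} ≪≫ₗ Finsupp.uniqueLinearEquiv ℤ ℤ ⟨x₀, rfl⟩⟩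

theorem exists_of_mem_homologySupport {i : ℤ} (h : i ∈ D.homologySupport) :
    ∃ s : D.State, i = D.numOnes s := by
  obtain ⟨j, hj⟩ := h
  by_contra! hn
  have hc : D.cycles i j = ⊥ := by
    refine eq_bot_iff.2 (inf_le_right.trans ?_)
    have : {x : D.EnhancedState | x.deg = i ∧ x.qdeg = j} = ∅ :=
      Set.eq_empty_of_forall_notMem fun x hx => hn x.state hx.1.symm
    rw [chains, this, Finsupp.supported_empty]
  have : Subsingleton (D.cycles i j) := hc ▸ inferInstance
  exact not_nontrivial _ hj

/-- The basis vector o a constant state with the same label on all circles. -/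
def constEnhanced (D : LinkDiagram) (b u : Bool) : D.EnhancedState := ⟨D.constState b, fun _ => u⟩

theorem constEnhanced_deg (b u : Bool) :
    (D.constEnhanced b u).deg = if b then (D.crossings : ℤ) else 0 := by
  cases b <;> simp [EnhancedState.deg, constEnhanced, constState, numOnes]

theorem state_eq_of_deg {x : D.EnhancedState} {b : Bool}
    (h : x.deg = if b then (D.crossings : ℤ) else 0) : x.state = D.constState b := by
  have h' := numOnes_add_stateDist x.state
  funext c
  by_contra hc
  unfold constState at hc
  cases b
  · have : 0 < D.numOnes x.state := Finset.card_pos.2 ⟨c, by simpa using hc⟩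
    simp [EnhancedState.deg] at h
    omega
  · have : 0 < stateDist (D.constState true) x.state :=
      Finset.card_pos.2 ⟨c, by simpa [constState] using hc⟩
    simp [EnhancedState.deg] at h
    omega

/-- Label degrees are `±1`, so a sum of extreme value has no term of the other sign. -/
theorem sum_labelDeg_eq_iff {ι : Type*} [Fintype ι] (f : ι → Bool) (u : Bool) :
    ∑ γ, labelDeg (f γ) = labelDeg u * Fintype.card ι ↔ ∀ γ, f γ = u := by
  refine ⟨fun h => ?_, fun h => ?_⟩
  swap
  · simp only [h, Finset.sum_const, Finset.card_univ, nsmul_eq_mul]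
    exact mul_comm _ _
  have h0 : ∀ γ ∈ Finset.univ, 0 ≤ 1 - labelDeg u * labelDeg (f γ) := by
    intro γ _
    cases u <;> cases f γ <;> simp [labelDeg]
  have h1 : ∑ γ, (1 - labelDeg u * labelDeg (f γ)) = 0 := by
    rw [Finset.sum_sub_distrib, ← Finset.mul_sum, h]
    cases u <;> simp [labelDeg]
  intro γ
  have := (Finset.sum_eq_zero_iff_of_nonneg h0).1 h1 γ (Finset.mem_univ _)
  revert this
  cases u <;> cases f γ <;> simp [labelDeg]

theorem eq_constEnhanced_iff (b u : Bool) (x : D.EnhancedState) :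
    (x.deg = (if b then (D.crossings : ℤ) else 0) ∧
      x.qdeg = labelDeg u * numCircles (D.constState b) + if b then (D.crossings : ℤ) else 0) ↔
    x = D.constEnhanced b u := by
  constructor
  · rintro ⟨h, hq⟩
    have hs := state_eq_of_deg h
    obtain ⟨s, l⟩ := x
    obtain rfl : s = D.constState b := hs
    rw [← h, EnhancedState.qdeg, EnhancedState.deg, add_left_inj, numCircles,
      Nat.card_eq_fintype_card, sum_labelDeg_eq_iff] at hq
    exact congrArg (EnhancedState.mk _) (funext hq)
  · rintro rfl
    refine ⟨constEnhanced_deg b u, ?_⟩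
    rw [← constEnhanced_deg b u, EnhancedState.qdeg, EnhancedState.deg, add_left_inj, numCircles,
      Nat.card_eq_fintype_card]
    exact (sum_labelDeg_eq_iff _ u).2 fun _ => rfl

/-- By adequacy every outgoing edge is a merge, and `X * X = 0`; incoming edges end at states with a
1-smoothing. -/
theorem nonempty_homology_equiv_zero (hD : D.IsKnot) (halt : D.IsAlternating)
    (hsplit : ∀ c, ¬ D.IsSplitting c) :
    Nonempty (D.Homology 0 (-numCircles (D.constState false)) ≃ₗ[ℤ] ℤ) := by
  refine nonempty_homology_equiv (x₀ := D.constEnhanced false false) (fun x => ?_)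
    (fun c y => ?_) (fun c x => ?_)
  · simpa [labelDeg] using eq_constEnhanced_iff false false x
  · have h := not_oneCircleAt_constState hD halt (hsplit c) false
    unfold edgeCoeff
    split_ifs with h1 h2 h3
    · simp [constEnhanced, mulCoeff]
    · exact absurd (not_not.1 h2) h
    · exact absurd (not_not.1 h2) h
    · rfl
  · refine if_neg ?_
    rintro ⟨-, h, -⟩
    simpa [constEnhanced, constState] using congrFun h c

/-- By adequacy every incoming edge is a split, and no coproduct contains `1 ⊗ 1`; there is no
0-smoothing left for an outgoing edge. -/
theorem nonempty_homology_equiv_crossings (hD : D.IsKnot) (halt : D.IsAlternating)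
    (hsplit : ∀ c, ¬ D.IsSplitting c) :
    Nonempty (D.Homology D.crossings (numCircles (D.constState true) + D.crossings) ≃ₗ[ℤ] ℤ) := by
  refine nonempty_homology_equiv (x₀ := D.constEnhanced true true) (fun x => ?_)
    (fun c y => ?_) (fun c x => ?_)
  · simpa [labelDeg] using eq_constEnhanced_iff true true x
  · exact if_neg fun h => by simpa [constEnhanced, constState] using h.1
  · have h := not_oneCircleAt_constState hD halt (hsplit c) true
    unfold edgeCoeff
    split_ifs with h1 h2 h3
    · obtain ⟨hx, hy, -⟩ := h1
      change D.constState true = _ at hy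
      refine absurd (oneCircleAt_of_not (t := x.state) (c := c) ?_ ?_ h) h2
      · intro c' e
        rw [hy, Function.update_of_ne e]
      · simp [hx, constState]
    · simp [constEnhanced, comulCoeff]
    · simp
    · rfl

end LinkDiagram

open LinkDiagram in
theorem theorem3p3 (D : LinkDiagram) (hknot : D.IsKnot) (halt : D.IsAlternating)
    (hsplit : ∀ c, ¬ D.IsSplitting c) :
    ∃ n₁ : ℕ, (∃ s, D.IsOneCircle s) ∧ (∀ s, D.IsOneCircle s → D.numOnes s = n₁) ∧
      ∃ iMinus iPlus : ℤ,
        IsLeast D.homologySupport iMinus ∧ IsGreatest D.homologySupport iPlus ∧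
        Nonempty (D.Homology iMinus (2 * iMinus - n₁ - 1) ≃ₗ[ℤ] ℤ) ∧
        Nonempty (D.Homology iPlus (2 * iPlus - n₁ + 1) ≃ₗ[ℤ] ℤ) ∧
        iMinus = 0 ∧ iPlus = D.crossings := by
  obtain ⟨s, hs⟩ := hknot.exists_isOneCircle
  have hn := numOnes_add_one hknot halt hs
  have hsum := numCircles_constState_add hknot halt
  obtain ⟨e₀⟩ := nonempty_homology_equiv_zero hknot halt hsplit
  obtain ⟨e₁⟩ := nonempty_homology_equiv_crossings hknot halt hsplit
  refine ⟨D.numOnes s, ⟨s, hs⟩, fun t ht => ?_, 0, D.crossings,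
    ⟨⟨_, e₀.toEquiv.nontrivial⟩, fun i hi => ?_⟩, ⟨⟨_, e₁.toEquiv.nontrivial⟩, fun i hi => ?_⟩,
    ?_, ?_, rfl, rfl⟩
  · have := numOnes_add_one hknot halt ht
    omega
  · obtain ⟨t, rfl⟩ := exists_of_mem_homologySupport hi
    exact Int.natCast_nonneg _
  · obtain ⟨t, rfl⟩ := exists_of_mem_homologySupport hi
    have := numOnes_add_stateDist t
    omega
  · rw [show 2 * (0 : ℤ) - D.numOnes s - 1 = -numCircles (D.constState false) by omega]
    exact ⟨e₀⟩
  · rw [show 2 * (D.crossings : ℤ) - D.numOnes s + 1 =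
      numCircles (D.constState true) + D.crossings by omega]
    exact ⟨e₁⟩
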